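/- Let $\Sigma$ be an alphabet, $\Sigma^+$ the free semigroup on $\Sigma$, and $k$ a positive integer. For $w\in\Sigma^+$ let $i_k(w)$ (respectively $t_k(w)$) be the prefix (respectively suffix) of $w$ of length $k$, or $w$ itself if $|w|<k$ (and the empty word if $k=0$), and let $F_k(w)$ be the set of factors of $w$ of length $k$. A language $L\subseteq\Sigma^+$ is *$k$-testable* if for all $u,v\in\Sigma^+$ with $i_{k-1}(u)=i_{k-1}(v)$, $t_{k-1}(u)=t_{k-1}(v)$ and $F_k(u)=F_k(v)$ one has $u\in L\iff v\in L$. A semigroup $S$ is *$k$-testable* if every language recognized by $S$ is $k$-testable, that is, if $\varphi^{-1}(P)$ is $k$-testable for every alphabet $\Sigma$, every homomorphism $\varphi:\Sigma^+\to S$ and every $P\subseteq S$ (equivalently, $S$ satisfies every identity $u=v$ with $i_{k-1}(u)=i_{k-1}(v)$, $t_{k-1}(u)=t_{k-1}(v)$, $F_k(u)=F_k(v)$). It is *locally testable* if it is $k$-testable for some positive integer $k$. **Theorem.** Let $S$ be a finite semigroup. The following conditions are equivalent: 1. $S$ is locally testable. 2. $eSe$ is $1$-testable for every idempotent $e\in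 S$. 3. $Se$ is $2$-testable for every idempotent $e\in S$. 4. $eS$ is $2$-testable for every idempotent $e\in S$. 5. $SeS$ is $2$-testable for every idempotent $e\in S$. Moreover, for every idempotent $e\in S$, the semigroup $eSe$ is $1$-testable if and only if it is commutative and idempotent (that is, $xy=yx$ and $x^2=x$ for all $x,y\in eSe$). -/

import Mathlib

universe u

/-- The nonempty list of letters of a word of the free semigroup `α⁺`. -/
def FreeSemigroup.letters {α : Type u} (w : FreeSemigroup α) : List α :=
  w.head :: w.tail

/-- `i_k(w)`: the prefix of `w` of length `k`, or `w` itself if `|w| < k`. -/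
def FreeSemigroup.prefixOf {α : Type u} (k : ℕ) (w : FreeSemigroup α) : List α :=
  w.letters.take k

/-- `t_k(w)`: the suffix of `w` of length `k`, or `w` itself if `|w| < k`. -/
def FreeSemigroup.suffixOf {α : Type u} (k : ℕ) (w : FreeSemigroup α) : List α :=
  w.letters.drop (w.letters.length - k)

/-- `F_k(w)`: the set of factors (contiguous subwords) of `w` of length `k`. -/
def FreeSemigroup.factorsOf {α : Type u} (k : ℕ) (w : FreeSemigroup α) : Set (List α) :=
  {x | x.length = k ∧ x <:+: w.letters}

/-- A language `L ⊆ α⁺` is `k`-testable (`k ≥ 1`) if membership of a word `w` in `L` depends only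
on `i_{k-1}(w)`, `t_{k-1}(w)` and `F_k(w)`. -/
def IsKTestableLanguage {α : Type u} (k : ℕ) (L : Set (FreeSemigroup α)) : Prop :=
  ∀ u v : FreeSemigroup α,
    u.prefixOf (k - 1) = v.prefixOf (k - 1) →
    u.suffixOf (k - 1) = v.suffixOf (k - 1) →
    u.factorsOf k = v.factorsOf k →
    (u ∈ L ↔ v ∈ L)

/-- A semigroup `S` is `k`-testable (`k ≥ 1`) if every language recognized by `S` is `k`-testable:
for every alphabet `α`, every homomorphism `φ : α⁺ → S` and every `P ⊆ S`, the language `φ⁻¹(P)` is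
`k`-testable. Taking for `P` the singletons, this says that `S` satisfies all the identities
`u = v` with `i_{k-1}(u) = i_{k-1}(v)`, `t_{k-1}(u) = t_{k-1}(v)`, `F_k(u) = F_k(v)`. -/
def IsKTestableSemigroup (k : ℕ) (S : Type u) [Semigroup S] : Prop :=
  ∀ (α : Type u) (φ : FreeSemigroup α →ₙ* S) (P : Set S), IsKTestableLanguage k (φ ⁻¹' P)

/-- A semigroup is locally testable if it is `k`-testable for some positive integer `k`. -/
def IsLocallyTestableSemigroup (S : Type u) [Semigroup S] : Prop :=
  ∃ k : ℕ, 0 < k ∧ IsKTestableSemigroup k S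

/-- The subsemigroup `eSe` of `S`. -/
def Subsemigroup.eSe {S : Type u} [Semigroup S] (e : S) : Subsemigroup S where
  carrier := {x | ∃ s : S, x = e * s * e}
  mul_mem' := by
    rintro _ _ ⟨s, rfl⟩ ⟨t, rfl⟩
    exact ⟨s * e * e * t, by simp only [mul_assoc]⟩

/-- The subsemigroup `Se` of `S`. -/
def Subsemigroup.Se {S : Type u} [Semigroup S] (e : S) : Subsemigroup S where
  carrier := {x | ∃ s : S, x = s * e}
  mul_mem' := by
    rintro _ _ ⟨s, rfl⟩ ⟨t, rfl⟩
    exact ⟨s * e * t, by simp only [mul_assoc]⟩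

/-- The subsemigroup `eS` of `S`. -/
def Subsemigroup.eS {S : Type u} [Semigroup S] (e : S) : Subsemigroup S where
  carrier := {x | ∃ s : S, x = e * s}
  mul_mem' := by
    rintro _ _ ⟨s, rfl⟩ ⟨t, rfl⟩
    exact ⟨s * e * t, by simp only [mul_assoc]⟩

/-- The subsemigroup `SeS` of `S`. -/
def Subsemigroup.SeS {S : Type u} [Semigroup S] (e : S) : Subsemigroup S where
  carrier := {x | ∃ s t : S, x = s * e * t}
  mul_mem' := by
    rintro _ _ ⟨s, t, rfl⟩ ⟨s', t', rfl⟩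
    exact ⟨s * e * t * s', t', by simp only [mul_assoc]⟩

/-! Every condition amounts to "each `eSe` is a semilattice" (`IsLocalSemilattice`). For necessity,
`IsKTestableSemigroup.comm_and_idem` pads words with long powers of `e`: for `x, y` in `eSe`, the
words `RxRyR` and `RyRxR` with `R = e^k` have the same `k`-test data, as do `RxRxR` and `RxR`.

The hard direction is from local semilattices to local testability. Words are read in the de Bruijn
automaton, whose vertices are words of length `n = |S| + 1` and whose edges are words of length `n +
1`; the test data of order `n + 1` are then the two ends and the edge set of a path. By pigeonhole
every vertex has a prefix whose value is fixed by some idempotent `e`, so that loops act there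
through `eSe`, hence as commuting idempotents. Simon's theorem `eq_of_edges_eq` on paths concludes.

For `SeS`, a product of elements `s * e * t` regroups into factors in `eSe` indexed by pairs of
consecutive letters; `Se` and `eS` are subsemigroups of `SeS`. -/

/-! ### Simon's theorem on paths in an automaton. -/

namespace PathAutomaton

variable {V A M : Type*} (δ : V → A → V)

/-- The set of edges traversed by the path that reads `z` from `v`. -/
def edges (v : V) : List A → Set (V × A)
  | [] => ∅
  | a :: z => insert (v, a) (edges (δ v a) z)

theorem edges_append (v : V) (x y : List A) :
    edges δ v (x ++ y) = edges δ v x ∪ edges δ (x.foldl δ v) y := by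
  induction x generalizing v with
  | nil => simp [edges]
  | cons a x ih => simp [edges, ih, Set.insert_union]

theorem mem_edges_iff {v c : V} {a : A} {x : List A} :
    (c, a) ∈ edges δ v x ↔ ∃ p q, x = p ++ a :: q ∧ p.foldl δ v = c := by
  constructor
  · induction x generalizing v with
    | nil => simp [edges]
    | cons b x ih =>
      rintro (h | h')
      · obtain ⟨rfl, rfl⟩ := Prod.mk.inj h
        exact ⟨[], x, rfl, rfl⟩
      · obtain ⟨p, q, rfl, h⟩ := ih h'
        exact ⟨b :: p, q, rfl, h⟩
  · rintro ⟨p, q, rfl, rfl⟩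
    simp [edges_append, edges]

/-- Splitting a path at its last edge with a given property. -/
theorem exists_split_last (P : V × A → Prop) (v : V) (x : List A) :
    (∀ f ∈ edges δ v x, P f) ∨
      ∃ p a q, x = p ++ a :: q ∧ ¬ P (p.foldl δ v, a) ∧
        ∀ f ∈ edges δ ((p ++ [a]).foldl δ v) q, P f := by
  induction x generalizing v with
  | nil => exact Or.inl (by simp [edges])
  | cons b x ih =>
    rcases ih (δ v b) with h | ⟨p, a, q, rfl, h1, h2⟩
    · by_cases hb : P (v, b)
      · left
        rintro f (rfl | hf)
        exacts [hb, h f hf]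
      · exact Or.inr ⟨[], b, x, rfl, hb, h⟩
    · exact Or.inr ⟨b :: p, a, q, rfl, h1, h2⟩

/-- The vertex `d` is reachable from the vertex `c` along edges of `C`. -/
def Reaches (C : Set (V × A)) (c d : V) : Prop :=
  ∃ r : List A, r.foldl δ c = d ∧ edges δ c r ⊆ C

variable {δ}

theorem Reaches.refl (C : Set (V × A)) (c : V) : Reaches δ C c c :=
  ⟨[], rfl, by simp [edges]⟩

theorem Reaches.trans {C : Set (V × A)} {c d f : V} (h : Reaches δ C c d)
    (h' : Reaches δ C d f) : Reaches δ C c f := by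
  obtain ⟨r, rfl, hr⟩ := h
  obtain ⟨s, rfl, hs⟩ := h'
  exact ⟨r ++ s, by simp, by rw [edges_append]; exact Set.union_subset hr hs⟩

theorem Reaches.of_mem {C : Set (V × A)} {c : V} {a : A} (h : (c, a) ∈ C) :
    Reaches δ C c (δ c a) :=
  ⟨[a], rfl, by simpa [edges] using h⟩

theorem reaches_source {C : Set (V × A)} {v c : V} {a : A} {x : List A}
    (h : edges δ v x ⊆ C) (hc : (c, a) ∈ edges δ v x) : Reaches δ C v c := by
  obtain ⟨p, q, rfl, rfl⟩ := (mem_edges_iff δ).1 hc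
  rw [edges_append] at h
  exact ⟨p, rfl, Set.subset_union_left.trans h⟩

theorem reaches_end {C : Set (V × A)} {v c : V} {a : A} {x : List A}
    (h : edges δ v x ⊆ C) (hc : (c, a) ∈ edges δ v x) :
    Reaches δ C (δ c a) (x.foldl δ v) := by
  obtain ⟨p, q, rfl, rfl⟩ := (mem_edges_iff δ).1 hc
  rw [edges_append] at h
  refine ⟨q, by simp, fun f hf => h (Or.inr (Or.inr hf))⟩

/-- Undo the edges one at a time, the last one first. -/
theorem reaches_start_of_returning {C : Set (V × A)} {v : V} {x : List A}
    (h : ∀ f ∈ edges δ v x, Reaches δ C (δ f.1 f.2) f.1) :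
    Reaches δ C (x.foldl δ v) v := by
  induction x generalizing v with
  | nil => exact Reaches.refl _ _
  | cons a x ih =>
    exact (ih fun f hf => h f (Or.inr hf)).trans (h (v, a) (Or.inl rfl))

variable [Monoid M]

/-- `Val v m` says that `m` is the value of some path that ends in `v`; the loops act on such values
as commuting idempotents. -/
structure LoopsCommute (δ : V → A → V) (g : A → M) (Val : V → M → Prop) : Prop where
  step : ∀ v m a, Val v m → Val (δ v a) (m * g a)
  idem : ∀ v m x, Val v m → List.foldl δ v x = v →
    m * (x.map g).prod * (x.map g).prod = m * (x.map g).prod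
  comm : ∀ v m x y, Val v m → List.foldl δ v x = v → List.foldl δ v y = v →
    m * (x.map g).prod * (y.map g).prod = m * (y.map g).prod * (x.map g).prod

namespace LoopsCommute

variable {g : A → M} {Val : V → M → Prop}

theorem val_foldl (H : LoopsCommute δ g Val) {v : V} {m : M} (hm : Val v m) (x : List A) :
    Val (x.foldl δ v) (m * (x.map g).prod) := by
  induction x generalizing v m with
  | nil => simpa using hm
  | cons a x ih => simpa [mul_assoc] using ih (H.step v m a hm)

/-- A detour along edges already used can be undone without changing the value. If the last edge `a`
of the detour `ya` occurs in `x = p a q`, then `aqy` is a loop after `p`; idempotency lets it be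
doubled, so if `z` undoes `y`, then `qyz` undoes `ya`. -/
theorem exists_return (H : LoopsCommute δ g Val) {v : V} {m : M} (hm : Val v m)
    (x y : List A) (hy : edges δ (x.foldl δ v) y ⊆ edges δ v x) :
    ∃ z, (y ++ z).foldl δ (x.foldl δ v) = x.foldl δ v ∧
      m * (x.map g).prod = m * (x.map g).prod * (y.map g).prod * (z.map g).prod := by
  induction y using List.reverseRecOn with
  | nil => exact ⟨[], by simp, by simp⟩
  | append_singleton y a ih =>
    rw [edges_append] at hy
    obtain ⟨z, hz, hmz⟩ := ih (Set.subset_union_left.trans hy)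
    obtain ⟨p, q, rfl, hp⟩ := (mem_edges_iff δ).1 (hy (Or.inr (Or.inl rfl)))
    refine ⟨q ++ y ++ z, ?_, ?_⟩
    · have h1 : List.foldl δ (δ (List.foldl δ v p) a) q = (p ++ a :: q).foldl δ v := by simp
      rw [List.foldl_append] at hz
      rw [List.append_assoc, List.foldl_append, List.foldl_append, List.foldl_cons, List.foldl_nil,
        ← hp, List.append_assoc, List.foldl_append, List.foldl_append, h1, hz]
    · have hl : (a :: q ++ y).foldl δ (p.foldl δ v) = p.foldl δ v := by
        rw [← List.foldl_append, ← List.append_assoc, List.foldl_append, ← hp]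
      have h2 := H.idem _ _ (a :: q ++ y) (H.val_foldl hm p) hl
      simp only [List.map_append, List.map_cons, List.prod_append, List.prod_cons, List.map_nil,
        List.prod_nil, mul_one, ← mul_assoc] at h2 hmz ⊢
      rw [h2]
      exact hmz

/-- A loop at the end of a path that uses only edges of this path can be erased. -/
theorem absorb (H : LoopsCommute δ g Val) {v : V} {m : M} (hm : Val v m)
    (x y : List A) (hl : y.foldl δ (x.foldl δ v) = x.foldl δ v)
    (hy : edges δ (x.foldl δ v) y ⊆ edges δ v x) :
    m * (x.map g).prod * (y.map g).prod = m * (x.map g).prod := by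
  obtain ⟨z, hz, hmz⟩ := H.exists_return hm x y hy
  have hv := H.val_foldl hm x
  -- Here `m x = m x (yz)`, so `m x y = m x (yz) y = m x y (yz) = m x yz = m x`.
  have h1 := H.comm _ _ (y ++ z) y hv hz hl
  have h2 := H.idem _ _ y hv hl
  simp only [List.map_append, List.prod_append, ← mul_assoc] at h1
  rw [← hmz, h2, ← hmz] at h1
  exact h1

/-- With `r` a return path, the loops `xr` and `yr` after `s` commute. In `s·xr·yr·x = s·yr·xr·x`,
absorption erases `ry` and `rx` on the left and `rx` twice on the right, leaving `sx = sy`. -/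
theorem eq_of_return (H : LoopsCommute δ g Val) {v : V} {m : M} (hm : Val v m)
    {C : Set (V × A)} (s x y : List A) (hx : edges δ v (s ++ x) = C)
    (hy : edges δ v (s ++ y) = C) (hxy : (s ++ x).foldl δ v = (s ++ y).foldl δ v)
    (hr : Reaches δ C ((s ++ x).foldl δ v) (s.foldl δ v)) :
    m * ((s ++ x).map g).prod = m * ((s ++ y).map g).prod := by
  obtain ⟨r, hr, hrC⟩ := hr
  have hxC : edges δ (s.foldl δ v) x ⊆ C := by
    rw [← hx, edges_append]; exact Set.subset_union_right
  have hyC : edges δ (s.foldl δ v) y ⊆ C := by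
    rw [← hy, edges_append]; exact Set.subset_union_right
  have hm' := H.val_foldl hm s
  have e1 : x.foldl δ (s.foldl δ v) = (s ++ x).foldl δ v := by simp
  have e2 : y.foldl δ (s.foldl δ v) = (s ++ x).foldl δ v := by rw [hxy]; simp
  have a1 := H.absorb hm (s ++ x) (r ++ y) (by rw [List.foldl_append, hr, e2])
    (by rw [edges_append, hr, hx]; exact Set.union_subset hrC hyC)
  have a2 := H.absorb hm (s ++ y) (r ++ x) (by rw [List.foldl_append, ← hxy, hr, e1])
    (by rw [edges_append, ← hxy, hr, hy]; exact Set.union_subset hrC hxC)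
  have hrx : (r ++ x).foldl δ ((s ++ x).foldl δ v) = (s ++ x).foldl δ v := by
    rw [List.foldl_append, hr, e1]
  have hry : (r ++ y).foldl δ ((s ++ x).foldl δ v) = (s ++ x).foldl δ v := by
    rw [List.foldl_append, hr, e2]
  have a3 := H.absorb hm (s ++ x) (r ++ x) hrx
    (by rw [edges_append, hr, hx]; exact Set.union_subset hrC hxC)
  have c1 := H.comm _ _ (x ++ r) (y ++ r) hm' (by rw [List.foldl_append, e1, hr])
    (by rw [List.foldl_append, e2, hr])
  have c2 := congrArg (· * (x.map g).prod) c1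
  have a4 := H.idem _ _ (r ++ x) (H.val_foldl hm (s ++ y)) (by rw [← hxy]; exact hrx)
  simp only [List.map_append, List.prod_append, ← mul_assoc] at a1 a2 a3 a4 c2 ⊢
  rw [a1, a3, a2, a2] at c2
  exact c2

/-- Simon's theorem: two coterminal paths with the same set of edges have the same value. -/
theorem eq_of_edges_eq (H : LoopsCommute δ g Val) {v : V} {m : M} (hm : Val v m)
    (x y : List A) (hxy : x.foldl δ v = y.foldl δ v) (he : edges δ v x = edges δ v y) :
    m * (x.map g).prod = m * (y.map g).prod := by
  induction hn : x.length using Nat.strong_induction_on generalizing x y with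
  | _ n ih =>
  subst hn
  obtain ⟨C, hC⟩ : ∃ C, edges δ v x = C := ⟨_, rfl⟩
  have hC' : edges δ v y = C := he ▸ hC
  -- Cut at the last edge that cannot be undone inside `C`. If there is none, the end reaches the
  -- start within `C` and `eq_of_return` applies to the whole path.
  rcases exists_split_last δ (fun f => Reaches δ C (δ f.1 f.2) f.1) v x with
    h | ⟨x₁, a, x₂, rfl, hna, hx₂⟩
  · exact H.eq_of_return hm [] x y hC hC' hxy (reaches_start_of_returning h)
  rcases exists_split_last δ (fun f => Reaches δ C (δ f.1 f.2) f.1) v y with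
    h | ⟨y₁, b, y₂, rfl, hnb, hy₂⟩
  · exact absurd (h (x₁.foldl δ v, a)
      (by rw [hC', ← hC, edges_append]; exact Or.inr (Or.inl rfl))) hna
  dsimp only at hna hnb
  rw [edges_append] at hC hC'
  simp only [edges] at hC hC'
  simp only [List.foldl_append, List.foldl_cons, List.foldl_nil] at hx₂ hy₂ hxy
  have sx₁ : edges δ v x₁ ⊆ C := hC ▸ Set.subset_union_left
  have sy₁ : edges δ v y₁ ⊆ C := hC' ▸ Set.subset_union_left
  have ha : (x₁.foldl δ v, a) ∈ C := hC ▸ Or.inr (Or.inl rfl)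
  have hb : (y₁.foldl δ v, b) ∈ C := hC' ▸ Or.inr (Or.inl rfl)
  have sx₂ : edges δ (δ (x₁.foldl δ v) a) x₂ ⊆ C := fun f hf => hC ▸ Or.inr (Or.inr hf)
  have sy₂ : edges δ (δ (y₁.foldl δ v) b) y₂ ⊆ C := fun f hf => hC' ▸ Or.inr (Or.inr hf)
  -- If the two cut edges differed, each would precede the other along one of the paths, and the
  -- first could be undone.
  have hab : (x₁.foldl δ v, a) = (y₁.foldl δ v, b) := by
    by_contra hne
    have h1 : (x₁.foldl δ v, a) ∈ edges δ v y₁ := by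
      rcases hC'.symm ▸ ha with h | h | h
      exacts [h, absurd h hne, absurd (hy₂ _ h) hna]
    have h2 : (y₁.foldl δ v, b) ∈ edges δ v x₁ := by
      rcases hC.symm ▸ hb with h | h | h
      exacts [h, absurd h.symm hne, absurd (hx₂ _ h) hnb]
    exact hna (((reaches_end sy₁ h1).trans (Reaches.of_mem hb)).trans (reaches_end sx₁ h2))
  obtain ⟨hc, rfl⟩ := Prod.mk.inj hab
  rw [← hc] at hC' hb sy₂ hy₂ hnb hxy
  -- An edge of one initial part occurring at or after the cut in the other path would allow a
  -- return across the cut edge. So the initial parts fall under induction and the tails under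
  -- `eq_of_return`.
  have key : edges δ v x₁ = edges δ v y₁ := by
    ext ⟨c, f⟩
    constructor
    · intro h
      rcases hC'.symm ▸ sx₁ h with h' | h' | h'
      · exact h'
      · exact absurd (reaches_end sx₁ (h' ▸ h)) hna
      · exact absurd (((reaches_source sy₂ h').trans (Reaches.of_mem (sx₁ h))).trans
          (reaches_end sx₁ h)) hna
    · intro h
      rcases hC.symm ▸ sy₁ h with h' | h' | h'
      · exact h'
      · have := reaches_end sy₁ (h' ▸ h)
        rw [← hc] at this
        exact absurd this hna
      · have := ((reaches_source sx₂ h').trans (Reaches.of_mem (sy₁ h))).trans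
          (reaches_end sy₁ h)
        rw [← hc] at this
        exact absurd this hna
  have h₁ := ih x₁.length (by simp) x₁ y₁ hc key rfl
  have h₂ := H.eq_of_return hm (C := C) (x₁ ++ [a]) x₂ y₂ (by simpa [edges_append, edges] using hC)
    (by simpa [edges_append, edges, key] using hC') (by simpa using hxy)
    (by simpa using reaches_start_of_returning hx₂)
  simp only [List.map_append, List.map_cons, List.prod_append, List.prod_cons, List.map_nil,
    List.prod_nil, mul_one, ← mul_assoc] at h₁ h₂ ⊢
  rw [h₂, h₁]

end LoopsCommute

end PathAutomaton

/-! ### Paths of the de Bruijn automaton as words. -/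

section DeBruijn

variable {A : Type*}

/-- The transitions of the de Bruijn automaton: a word is replaced by its last `n` letters after
appending a letter. -/
def shift (c : List A) (a : A) : List A :=
  (c ++ [a]).tail

theorem foldl_shift (c z : List A) : z.foldl shift c = (c ++ z).drop z.length := by
  induction z generalizing c with
  | nil => simp
  | cons a z ih =>
    rw [List.foldl_cons, ih, shift, ← List.tail_append_of_ne_nil (by simp), ← List.drop_one,
      List.drop_drop]
    simp [Nat.add_comm]

/-- This turns equality of sets of factors into equality of edge sets, the hypothesis of Simon's
theorem. -/
theorem mem_edges_shift_iff {c z b : List A} {a : A} :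
    (b, a) ∈ PathAutomaton.edges shift c z ↔ b.length = c.length ∧ b ++ [a] <:+: c ++ z := by
  rw [PathAutomaton.mem_edges_iff]
  constructor
  · rintro ⟨p, q, rfl, rfl⟩
    rw [foldl_shift]
    refine ⟨by simp, (c ++ p).take p.length, q, ?_⟩
    rw [← List.append_assoc, List.take_append_drop]
    simp
  · rintro ⟨hl, s, t, h⟩
    have h' : (s ++ b) ++ (a :: t) = c ++ z := by simpa using h
    have hp : c <+: s ++ b := by
      refine List.prefix_of_prefix_length_le ⟨z, rfl⟩ ⟨a :: t, h'⟩ ?_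
      simp [hl]
    obtain ⟨p, hp⟩ := hp
    have hps : p.length = s.length := by
      have := congrArg List.length hp
      simp only [List.length_append] at this
      omega
    refine ⟨p, t, ?_, ?_⟩
    · rw [← hp, List.append_assoc] at h'
      exact (List.append_cancel_left h').symm
    · rw [foldl_shift, hp, hps, List.drop_left]

end DeBruijn

/-! ### Local semilattices are locally testable. -/

section LocalSemilattice

variable {S : Type u} [Semigroup S]

theorem WithOne.exists_coe_eq_prod {A : Type*} (f : A → S) {l : List A} (hl : l ≠ []) :
    ∃ s : S, (l.map fun a => (f a : WithOne S)).prod = s := by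
  induction l with
  | nil => exact absurd rfl hl
  | cons a l ih =>
    by_cases h : l = []
    · exact ⟨f a, by simp [h]⟩
    · obtain ⟨s, hs⟩ := ih h
      exact ⟨f a * s, by simp [hs]⟩

theorem FreeSemigroup.letters_mul {A : Type*} (u v : FreeSemigroup A) :
    (u * v).letters = u.letters ++ v.letters := rfl

theorem FreeSemigroup.coe_hom_eq_prod {A : Type*} (φ : FreeSemigroup A →ₙ* S)
    (w : FreeSemigroup A) :
    (φ w : WithOne S) = (w.letters.map fun a => (φ (FreeSemigroup.of a) : WithOne S)).prod := by
  induction w using FreeSemigroup.recOnMul with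
  | ih1 a => simp [letters, FreeSemigroup.of]
  | ih2 a w h1 h2 =>
    rw [map_mul, WithOne.coe_mul, h1, h2, letters_mul, List.map_append, List.prod_append]

/-- The stabilizer of `m` is a nonempty finite subsemigroup, compact in the discrete topology, so it
contains an idempotent. -/
theorem exists_idempotent_stabilizer [Finite S] {m : WithOne S} {s : S} (h : m * s = m) :
    ∃ e : S, IsIdempotentElem e ∧ m * e = m := by
  let _ : TopologicalSpace S := ⊥
  have : DiscreteTopology S := ⟨rfl⟩
  obtain ⟨e, he, hee⟩ := exists_idempotent_in_compact_subsemigroup (M := S)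
    (fun _ => continuous_of_discreteTopology) {t : S | m * t = m} ⟨s, h⟩
    (Set.toFinite _).isCompact (by
      intro x hx y hy
      simp only [Set.mem_ofPred_eq, WithOne.coe_mul] at *
      rw [← mul_assoc, hx, hy])
  exact ⟨e, hee, he⟩

/-- A long product has a prefix stabilized by an idempotent. -/
theorem exists_prefix_stabilizer [Finite S] {A : Type*} (f : A → S) (c : List A)
    (hc : Nat.card (WithOne S) ≤ c.length) :
    ∃ (c₁ c₂ : List A) (e : S), c = c₁ ++ c₂ ∧ IsIdempotentElem e ∧
      (c₁.map fun a => (f a : WithOne S)).prod * e = (c₁.map fun a => (f a : WithOne S)).prod := by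
  have : Finite (WithOne S) := inferInstanceAs (Finite (Option S))
  have := Fintype.ofFinite (WithOne S)
  -- There are `c.length + 1` prefixes, counting the empty one, and fewer possible values.
  obtain ⟨i, j, hij, h⟩ := Fintype.exists_ne_map_eq_of_card_lt
    (fun i : Fin (c.length + 1) => ((c.take i).map fun a => (f a : WithOne S)).prod)
    (by rw [Fintype.card_fin, ← Nat.card_eq_fintype_card]; omega)
  wlog hlt : i < j generalizing i j
  · exact this j i hij.symm h.symm (lt_of_le_of_ne (not_lt.1 hlt) hij.symm)
  have hj : c.take j = c.take i ++ (c.take j).drop i := by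
    conv_lhs => rw [← List.take_append_drop i (c.take j)]
    rw [List.take_take, min_eq_left (show (i : ℕ) ≤ j from le_of_lt hlt)]
  obtain ⟨s, hs⟩ := WithOne.exists_coe_eq_prod f (l := (c.take j).drop i) (by
    intro h0
    have := congrArg List.length h0
    have h1 := j.2
    have h2 : (i : ℕ) < j := hlt
    simp only [List.length_drop, List.length_take, List.length_nil] at this
    omega)
  rw [hj, List.map_append, List.prod_append, hs] at h
  obtain ⟨e, he, hm⟩ := exists_idempotent_stabilizer h.symm
  exact ⟨_, _, e, (List.take_append_drop i c).symm, he, hm⟩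

/-- All the subsemigroups `eSe` are commutative and idempotent. -/
def IsLocalSemilattice (S : Type u) [Semigroup S] : Prop :=
  ∀ e : S, IsIdempotentElem e → ∀ s t : S,
    (e * s * e) * (e * t * e) = (e * t * e) * (e * s * e) ∧ (e * s * e) * (e * s * e) = e * s * e

/-- A loop of the de Bruijn automaton at `c₁ ++ c₂` acts like an element of `eSe`. -/
theorem exists_local_action {A : Type*} (f : A → S) {c₁ c₂ z : List A} {e : S}
    (he : IsIdempotentElem e) (hz : z.foldl shift (c₁ ++ c₂) = c₁ ++ c₂) :
    ∃ (s : S) (t y : WithOne S),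
      (c₂.map fun a => (f a : WithOne S)).prod * (z.map fun a => (f a : WithOne S)).prod =
        t * (c₂.map fun a => (f a : WithOne S)).prod ∧
      (c₁.map fun a => (f a : WithOne S)).prod * t =
        y * (c₁.map fun a => (f a : WithOne S)).prod ∧
      ((e * s * e : S) : WithOne S) = e * t * e := by
  rw [foldl_shift] at hz
  obtain ⟨y, hy⟩ : ∃ y, c₁ ++ c₂ ++ z = y ++ (c₁ ++ c₂) :=
    ⟨_, by conv_lhs => rw [← List.take_append_drop z.length (c₁ ++ c₂ ++ z), hz]⟩
  -- From `c₁c₂z = y c₁c₂`, comparing suffixes gives `c₂z = t c₂` and then `c₁t = y c₁`: the loop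
  -- `z` moved to the left past `c₂`.
  have hsuf : c₂ <:+ c₂ ++ z :=
    List.suffix_of_suffix_length_le (l₃ := c₁ ++ c₂ ++ z) ⟨y ++ c₁, by rw [hy]; simp⟩
      ⟨c₁, by simp⟩ (by simp)
  obtain ⟨t, ht⟩ := hsuf
  have hyt : c₁ ++ t = y ++ c₁ := by
    rw [List.append_assoc, ← ht, ← List.append_assoc, ← List.append_assoc] at hy
    exact List.append_cancel_right hy
  have h1 := congrArg (fun l => (List.map (fun a => (f a : WithOne S)) l).prod) ht
  have h2 := congrArg (fun l => (List.map (fun a => (f a : WithOne S)) l).prod) hyt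
  simp only [List.map_append, List.prod_append] at h1 h2
  -- For empty `t` the value is the adjoined unit, not an element of `S`; `s = e` gives the same
  -- local element.
  by_cases h0 : t = []
  · subst h0
    exact ⟨e, _, _, h1.symm, h2, by simp [← WithOne.coe_mul, he.eq]⟩
  · obtain ⟨s, hs'⟩ := WithOne.exists_coe_eq_prod f h0
    exact ⟨s, _, _, h1.symm, h2, by simp [hs']⟩

/-- Two loops of the de Bruijn automaton at `c₁ ++ c₂` act like elements of `eSe`. -/
theorem exists_local_actions {A : Type*} (f : A → S) {c₁ c₂ z z' : List A} {e : S}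
    (he : IsIdempotentElem e)
    (hs : (c₁.map fun a => (f a : WithOne S)).prod * e = (c₁.map fun a => (f a : WithOne S)).prod)
    (hz : z.foldl shift (c₁ ++ c₂) = c₁ ++ c₂) (hz' : z'.foldl shift (c₁ ++ c₂) = c₁ ++ c₂) :
    ∃ s s' : S, ∀ P Q Z Z' : WithOne S,
      P = (c₁.map fun a => (f a : WithOne S)).prod → Q = (c₂.map fun a => (f a : WithOne S)).prod →
      Z = (z.map fun a => (f a : WithOne S)).prod → Z' = (z'.map fun a => (f a : WithOne S)).prod →
      P * Q * Z = P * (e * s * e : S) * Q ∧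
      P * Q * Z * Z' = P * ((e * s * e) * (e * s' * e) : S) * Q ∧
      P * Q * Z' * Z = P * ((e * s' * e) * (e * s * e) : S) * Q ∧
      P * Q * Z * Z = P * ((e * s * e) * (e * s * e) : S) * Q := by
  obtain ⟨s, t, y, h1, h2, h3⟩ := exists_local_action f he hz
  obtain ⟨s', t', y', h1', h2', h3'⟩ := exists_local_action f he hz'
  refine ⟨s, s', ?_⟩
  rintro P Q Z Z' hP hQ hZ hZ'
  rw [← hP] at hs
  rw [← hQ, ← hZ] at h1
  rw [← hQ, ← hZ'] at h1'
  rw [← hP] at h2 h2'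
  -- Since `P * e = P`, the left `e` is absorbed by `P`; the right one is absorbed because `P * t =
  -- y * P` also ends in `P`.
  have loc : ∀ (s : S) (t y : WithOne S), P * t = y * P →
      ((e * s * e : S) : WithOne S) = e * t * e → P * t = P * (e * s * e : S) := by
    intro s t y h2 h3
    rw [h3, ← mul_assoc, ← mul_assoc, hs, h2, mul_assoc, hs]
  have two : ∀ (s s' : S) (t t' y : WithOne S), P * t = y * P →
      P * t = P * (e * s * e : S) → P * t' = P * (e * s' * e : S) →
      P * t * t' = P * ((e * s * e) * (e * s' * e) : S) := by
    intro s s' t t' y h2 l l'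
    rw [h2, mul_assoc, l', ← mul_assoc, ← h2, l, WithOne.coe_mul (e * s * e), mul_assoc]
  have l := loc s t y h2 h3
  have l' := loc s' t' y' h2' h3'
  rw [← two s s' t t' y h2 l l', ← two s' s t' t y' h2' l' l, ← two s s t t y h2 l l, ← l]
  simp only [mul_assoc] at h1 h1' ⊢
  refine ⟨by rw [h1], ?_, ?_, ?_⟩
  · rw [← mul_assoc Q, h1, mul_assoc, h1']
  · rw [← mul_assoc Q, h1', mul_assoc, h1]
  · rw [← mul_assoc Q, h1, mul_assoc, h1]

theorem IsLocalSemilattice.loopsCommute [Finite S] (hS : IsLocalSemilattice S) {A : Type*}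
    (f : A → S) {n : ℕ} (hn : Nat.card (WithOne S) ≤ n) :
    PathAutomaton.LoopsCommute shift (fun a => (f a : WithOne S)) (fun c m =>
      c.length = n ∧ ∃ d : List A, m = ((d ++ c).map fun a => (f a : WithOne S)).prod) where
  step := by
    rintro c m a ⟨hc, d, rfl⟩
    cases c with
    | nil =>
      have : Finite (WithOne S) := inferInstanceAs (Finite (Option S))
      have : 0 < Nat.card (WithOne S) := Nat.card_pos
      simp at hc
      omega
    | cons b c =>
      exact ⟨by simpa [shift] using hc, d ++ [b], by simp [shift, mul_assoc]⟩
  idem := by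
    rintro c m z ⟨hc, d, rfl⟩ hz
    obtain ⟨c₁, c₂, e, rfl, he, hs⟩ := exists_prefix_stabilizer f c (by omega)
    obtain ⟨s, s', h⟩ := exists_local_actions f he hs hz hz
    obtain ⟨h1, -, -, h2⟩ := h _ _ _ _ rfl rfl rfl rfl
    rw [(hS e he s s').2, ← h1] at h2
    simp only [List.map_append, List.prod_append, mul_assoc] at h2 ⊢
    rw [h2]
  comm := by
    rintro c m z z' ⟨hc, d, rfl⟩ hz hz'
    obtain ⟨c₁, c₂, e, rfl, he, hs⟩ := exists_prefix_stabilizer f c (by omega)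
    obtain ⟨s, s', h⟩ := exists_local_actions f he hs hz hz'
    obtain ⟨-, h1, h2, -⟩ := h _ _ _ _ rfl rfl rfl rfl
    rw [(hS e he s s').1, ← h2] at h1
    simp only [List.map_append, List.prod_append, mul_assoc] at h1 ⊢
    rw [h1]

theorem isKTestableSemigroup_iff {k : ℕ} {T : Type u} [Semigroup T] :
    IsKTestableSemigroup k T ↔ ∀ (α : Type u) (φ : FreeSemigroup α →ₙ* T) (u v : FreeSemigroup α),
      u.prefixOf (k - 1) = v.prefixOf (k - 1) → u.suffixOf (k - 1) = v.suffixOf (k - 1) →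
      u.factorsOf k = v.factorsOf k → φ u = φ v := by
  constructor
  · intro h α φ u v h1 h2 h3
    exact (h α φ {φ v} u v h1 h2 h3).2 rfl
  · intro h α φ P u v h1 h2 h3
    rw [Set.mem_preimage, Set.mem_preimage, h α φ u v h1 h2 h3]

theorem FreeSemigroup.length_letters_lt_iff {A : Type*} {k : ℕ} {w : FreeSemigroup A} :
    w.letters.length < k ↔ w.factorsOf k = ∅ := by
  constructor
  · intro h
    ext x
    simp only [factorsOf, Set.mem_ofPred_eq, Set.mem_empty_iff_false, iff_false, not_and]
    rintro rfl hx
    exact absurd hx.length_le (not_le.2 h)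
  · intro h
    by_contra hk
    have : w.letters.take k ∈ w.factorsOf k :=
      ⟨by simpa using hk, (List.take_prefix _ _).isInfix⟩
    rw [h] at this
    exact this

theorem FreeSemigroup.letters_injective {A : Type*} :
    Function.Injective (FreeSemigroup.letters (α := A)) := by
  intro u v h
  obtain ⟨h1, h2⟩ := List.cons.inj h
  exact FreeSemigroup.ext h1 h2

theorem IsLocalSemilattice.isLocallyTestable [Finite S] (hS : IsLocalSemilattice S) :
    IsLocallyTestableSemigroup S := by
  set n := Nat.card (WithOne S) with hn
  refine ⟨n + 1, Nat.succ_pos _, isKTestableSemigroup_iff.2 ?_⟩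
  intro α φ u v h1 h2 h3
  rw [Nat.add_sub_cancel] at h1 h2
  -- Words of length at most `n` have no factor of length `n + 1`, and their prefix of length `n` is
  -- the whole word.
  by_cases hu : u.letters.length < n + 1
  · have hv : v.letters.length < n + 1 := by
      rw [FreeSemigroup.length_letters_lt_iff] at hu ⊢
      rw [← h3, hu]
    rw [FreeSemigroup.prefixOf, FreeSemigroup.prefixOf, List.take_of_length_le (by omega),
      List.take_of_length_le (by omega)] at h1
    rw [FreeSemigroup.letters_injective h1]
  have hv : ¬ v.letters.length < n + 1 := by
    rw [FreeSemigroup.length_letters_lt_iff] at hu ⊢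
    rwa [← h3]
  have hc : (u.prefixOf n).length = n := by
    simp only [FreeSemigroup.prefixOf, List.length_take]; omega
  have eu : u.letters = u.prefixOf n ++ u.letters.drop n := (List.take_append_drop _ _).symm
  have ev : v.letters = u.prefixOf n ++ v.letters.drop n := by
    rw [h1]; exact (List.take_append_drop _ _).symm
  -- Both words start at the vertex given by their common prefix of length `n`; the common suffix
  -- makes the paths coterminal.
  have key := (hS.loopsCommute (fun a => φ (FreeSemigroup.of a)) hn.ge).eq_of_edges_eq
    (v := u.prefixOf n) ⟨hc, [], rfl⟩ (u.letters.drop n) (v.letters.drop n)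
    (by
      rw [foldl_shift, foldl_shift, ← eu, ← ev, List.length_drop, List.length_drop]
      exact h2)
    (by
      ext ⟨b, a⟩
      rw [mem_edges_shift_iff, mem_edges_shift_iff, ← eu, ← ev, hc]
      have := Set.ext_iff.1 h3 (b ++ [a])
      simpa [FreeSemigroup.factorsOf] using this)
  rw [List.nil_append, ← List.prod_append, ← List.prod_append, ← List.map_append, ← List.map_append,
    ← eu, ← ev, ← FreeSemigroup.coe_hom_eq_prod, ← FreeSemigroup.coe_hom_eq_prod] at key
  exact WithOne.coe_injective key

end LocalSemilattice

/-! ### Testability of `SeS`, and necessity of the local condition. -/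

section Testable

theorem List.mul_prod_of_mem_semilattice {M : Type*} [Monoid M] {X : Set M}
    (hc : ∀ x ∈ X, ∀ y ∈ X, x * y = y * x) (hi : ∀ x ∈ X, x * x = x) {l : List M}
    (hl : ∀ x ∈ l, x ∈ X) {a : M} (ha : a ∈ l) : a * l.prod = l.prod := by
  induction l with
  | nil => simp at ha
  | cons b l ih =>
    simp only [List.forall_mem_cons] at hl
    rw [List.prod_cons, ← mul_assoc]
    rcases List.mem_cons.1 ha with rfl | h
    · rw [hi a hl.1]
    · rw [hc a (hl.2 a h) b hl.1, mul_assoc, ih hl.2 h]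

/-- A product in a semilattice depends only on the set of its factors. -/
theorem List.prod_eq_of_mem_semilattice {M : Type*} [Monoid M] {X : Set M}
    (hc : ∀ x ∈ X, ∀ y ∈ X, x * y = y * x) (hi : ∀ x ∈ X, x * x = x) {l l' : List M}
    (hl : ∀ x ∈ l, x ∈ X) (h : ∀ x, x ∈ l ↔ x ∈ l') : l.prod = l'.prod := by
  have hl' : ∀ x ∈ l', x ∈ X := fun x hx => hl x ((h x).2 hx)
  -- Absorption of `l₁` by `l₂` in both directions, with commutativity, forces the two products to
  -- agree.
  have key : ∀ l₁ l₂ : List M, (∀ x ∈ l₂, x ∈ X) → (∀ x ∈ l₁, x ∈ l₂) →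
      l₁.prod * l₂.prod = l₂.prod := by
    intro l₁ l₂ h₂ h
    induction l₁ with
    | nil => simp
    | cons a l₁ ih =>
      simp only [List.forall_mem_cons] at h
      rw [List.prod_cons, mul_assoc, ih h.2, List.mul_prod_of_mem_semilattice hc hi h₂ h.1]
  have hcomm : Commute l.prod l'.prod :=
    Commute.list_prod_left _ _ fun x hx => Commute.list_prod_right _ _ fun y hy =>
      hc x (hl x hx) y (hl' y hy)
  rw [← key l' l hl fun x hx => (h x).2 hx, ← hcomm.eq, key l l' hl' fun x hx => (h x).1 hx]

theorem List.mem_zip_tail_iff {A : Type*} {l : List A} {a b : A} :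
    (a, b) ∈ l.zip l.tail ↔ [a, b] <:+: l := by
  induction l with
  | nil => simp
  | cons c l ih =>
    cases l with
    | nil => simp [List.infix_cons_iff]
    | cons d l =>
      rw [List.infix_cons_iff, ← ih]
      simp [List.cons_prefix_cons]

/-- Regrouping a product of elements `σ a * e * τ a` into a product of elements of `eMe`. -/
theorem List.prod_regroup {M A : Type*} [Monoid M] {e : M} (he : e * e = e) (σ τ : A → M)
    (a : A) (l : List A) :
    ((a :: l).map fun a => σ a * e * τ a).prod =
      σ a * e * (((a :: l).zip l).map fun p => e * (τ p.1 * σ p.2) * e).prod *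
        (e * τ ((a :: l).getLast (List.cons_ne_nil a l))) := by
  have he' : ∀ x, e * (e * x) = e * x := fun x => by rw [← mul_assoc, he]
  induction l generalizing a with
  | nil => simp [mul_assoc, he']
  | cons b l ih =>
    rw [List.map_cons, List.prod_cons, ih]
    simp [mul_assoc, he']

variable {S : Type u} [Semigroup S]

theorem IsKTestableSemigroup.of_injective {k : ℕ} {T : Type u} [Semigroup T]
    (h : IsKTestableSemigroup k S) (f : T →ₙ* S) (hf : Function.Injective f) :
    IsKTestableSemigroup k T := by
  rw [isKTestableSemigroup_iff] at h ⊢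
  intro α φ u v h1 h2 h3
  exact hf (h α (f.comp φ) u v h1 h2 h3)

theorem IsKTestableSemigroup.of_le {k : ℕ} {T T' : Subsemigroup S}
    (h : IsKTestableSemigroup k T') (hT : T ≤ T') : IsKTestableSemigroup k T :=
  h.of_injective (Subsemigroup.inclusion hT) (Set.inclusion_injective hT)

theorem FreeSemigroup.letters_ne_nil {A : Type*} (w : FreeSemigroup A) : w.letters ≠ [] :=
  List.cons_ne_nil _ _

/-- Write the image of each letter `a` as `σ a * e * τ a`. The ends of the product depend only on
the first and last letters. Its middle is a product of elements `e * (τ a * σ b) * e` over the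
factors `ab`, and in a semilattice only the set of these matters. -/
theorem IsLocalSemilattice.isKTestableSemigroup_SeS (hS : IsLocalSemilattice S) {e : S}
    (he : IsIdempotentElem e) : IsKTestableSemigroup 2 (Subsemigroup.SeS e) := by
  rw [isKTestableSemigroup_iff]
  intro α φ u v h1 h2 h3
  obtain ⟨ψ, hψ⟩ : ∃ ψ : FreeSemigroup α →ₙ* S, ∀ w, ψ w = φ w :=
    ⟨(MulMemClass.subtype _).comp φ, fun _ => rfl⟩
  apply Subtype.ext
  rw [← hψ, ← hψ]
  have hst : ∀ a, ∃ s t, ψ (FreeSemigroup.of a) = s * e * t := fun a =>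
    hψ (FreeSemigroup.of a) ▸ (φ (FreeSemigroup.of a)).2
  choose σ τ hστ using hst
  have hw : ∀ w : FreeSemigroup α, (ψ w : WithOne S) = (σ w.head : WithOne S) * e *
      ((w.letters.zip w.letters.tail).map fun p =>
        ((e * (τ p.1 * σ p.2) * e : S) : WithOne S)).prod *
      (e * τ (w.letters.getLast w.letters_ne_nil)) := by
    intro w
    rw [FreeSemigroup.coe_hom_eq_prod]
    simp only [hστ, WithOne.coe_mul]
    exact List.prod_regroup (by rw [← WithOne.coe_mul, he.eq]) (fun a => (σ a : WithOne S))
      (fun a => (τ a : WithOne S)) w.head w.tail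
  have hhead : u.head = v.head := by
    simpa [FreeSemigroup.prefixOf, FreeSemigroup.letters] using h1
  have hlast : u.letters.getLast u.letters_ne_nil =
      v.letters.getLast v.letters_ne_nil := by
    simp only [FreeSemigroup.suffixOf, Nat.add_one_sub_one] at h2
    rw [List.drop_length_sub_one u.letters_ne_nil, List.drop_length_sub_one v.letters_ne_nil] at h2
    simpa using h2
  have hmem : ∀ p, p ∈ u.letters.zip u.letters.tail ↔ p ∈ v.letters.zip v.letters.tail := by
    rintro ⟨a, b⟩
    rw [List.mem_zip_tail_iff, List.mem_zip_tail_iff]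
    simpa [FreeSemigroup.factorsOf] using Set.ext_iff.1 h3 [a, b]
  apply WithOne.coe_injective
  rw [hw u, hw v, hhead, hlast]
  congr 2
  refine List.prod_eq_of_mem_semilattice
    (X := {x : WithOne S | ∃ s : S, x = ((e * s * e : S) : WithOne S)}) ?_ ?_ ?_ ?_
  · rintro _ ⟨s, rfl⟩ _ ⟨t, rfl⟩
    rw [← WithOne.coe_mul, (hS e he s t).1, WithOne.coe_mul]
  · rintro _ ⟨s, rfl⟩
    rw [← WithOne.coe_mul, (hS e he s s).2]
  · intro x hx
    obtain ⟨p, -, rfl⟩ := List.mem_map.1 hx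
    exact ⟨_, rfl⟩
  · intro x
    simp only [List.mem_map, hmem]

theorem isKTestableSemigroup_one_of_comm_idem {T : Type u} [Semigroup T]
    (hc : ∀ x y : T, x * y = y * x) (hi : ∀ x : T, x * x = x) : IsKTestableSemigroup 1 T := by
  rw [isKTestableSemigroup_iff]
  intro α φ u v _ _ h3
  have hmem : ∀ a, a ∈ u.letters ↔ a ∈ v.letters := by
    intro a
    simpa [FreeSemigroup.factorsOf, List.singleton_infix_iff] using Set.ext_iff.1 h3 [a]
  apply WithOne.coe_injective
  rw [FreeSemigroup.coe_hom_eq_prod, FreeSemigroup.coe_hom_eq_prod]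
  refine List.prod_eq_of_mem_semilattice
    (X := Set.range ((↑) : T → WithOne T)) ?_ ?_ ?_ ?_
  · rintro _ ⟨s, rfl⟩ _ ⟨t, rfl⟩
    rw [← WithOne.coe_mul, hc, WithOne.coe_mul]
  · rintro _ ⟨s, rfl⟩
    rw [← WithOne.coe_mul, hi]
  · intro x hx
    obtain ⟨a, -, rfl⟩ := List.mem_map.1 hx
    exact ⟨_, rfl⟩
  · intro x
    simp only [List.mem_map, hmem]

/-- A factor meeting both `X` and `Z` would have to be longer than `Y`. -/
theorem List.infix_append_append_iff {A : Type*} {f X Y Z : List A} (h : f.length ≤ Y.length) :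
    f <:+: X ++ Y ++ Z ↔ f <:+: X ++ Y ∨ f <:+: Y ++ Z := by
  constructor
  · rintro ⟨s, t, hst⟩
    rcases le_total s.length X.length with hs | hs
    · left
      obtain ⟨r, hr⟩ := List.prefix_of_prefix_length_le (l₁ := s ++ f) (l₂ := X ++ Y)
        (l₃ := X ++ Y ++ Z) ⟨t, hst⟩ ⟨Z, rfl⟩ (by simp; omega)
      exact ⟨s, r, hr⟩
    · right
      have hl := congrArg List.length hst
      simp only [List.length_append] at hl
      obtain ⟨r, hr⟩ := List.suffix_of_suffix_length_le (l₁ := f ++ t) (l₂ := Y ++ Z)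
        (l₃ := X ++ Y ++ Z) ⟨s, by rw [← hst]; simp⟩ ⟨X, by simp⟩ (by simp; omega)
      exact ⟨r, t, by rw [← hr]; simp⟩
  · rintro (h | h)
    · exact h.trans ⟨[], Z, by simp⟩
    · exact h.trans ⟨X, [], by simp⟩

/-- In a `k`-testable semigroup, the elements of `eTe` form a semilattice. -/
theorem IsKTestableSemigroup.comm_and_idem {k : ℕ} (hk : 0 < k) {T : Type u} [Semigroup T]
    (h : IsKTestableSemigroup k T) {e x y : T} (he : IsIdempotentElem e)
    (hx : e * x * e = x) (hy : e * y * e = y) : x * y = y * x ∧ x * x = x := by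
  rw [isKTestableSemigroup_iff] at h
  obtain ⟨j, rfl⟩ : ∃ j, k = j + 1 := ⟨k - 1, by omega⟩
  -- Padding by `R` on both sides fixes the prefix and suffix of length `j = k - 1`, so only factors
  -- of length `k` remain to be compared, while `R` has value `e`.
  obtain ⟨R, hR⟩ : ∃ R, R = List.replicate (j + 1) e := ⟨_, rfl⟩
  have hRl : R.length = j + 1 := by simp [hR]
  have hword : ∀ X : List T, ∃ w : FreeSemigroup T, w.letters = R ++ X ++ R := fun X =>
    ⟨⟨e, List.replicate j e ++ X ++ R⟩, by
      simp [FreeSemigroup.letters, hR, List.replicate_succ]⟩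
  have hval : ∀ w : FreeSemigroup T,
      ((FreeSemigroup.lift id w : T) : WithOne T) = (w.letters.map fun a : T => (a : WithOne T)).prod :=
    fun w => by simpa using FreeSemigroup.coe_hom_eq_prod (FreeSemigroup.lift id) w
  have hRp : (R.map fun a : T => (a : WithOne T)).prod = (e : WithOne T) := by
    have he' : IsIdempotentElem (e : WithOne T) := by
      rw [IsIdempotentElem, ← WithOne.coe_mul, he.eq]
    rw [hR, List.map_replicate, List.prod_replicate, he'.pow_succ_eq]
  have key : ∀ X X' : List T, (∀ f : List T, f.length = j + 1 →
      (f <:+: R ++ X ++ R ↔ f <:+: R ++ X' ++ R)) →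
      (e : WithOne T) * (X.map fun a : T => (a : WithOne T)).prod * e =
        e * (X'.map fun a : T => (a : WithOne T)).prod * e := by
    intro X X' hf
    obtain ⟨u, hu⟩ := hword X
    obtain ⟨v, hv⟩ := hword X'
    have hsuf : ∀ Y : List T, (Y ++ R).drop ((Y ++ R).length - j) = R.drop (R.length - j) := by
      intro Y
      rw [List.drop_append, List.drop_of_length_le (by simp; omega), List.nil_append]
      congr 1
      simp
      omega
    have := h T (FreeSemigroup.lift id) u v
      (by
        simp only [FreeSemigroup.prefixOf, hu, hv, List.append_assoc]
        rw [List.take_append_of_le_length (by simp [hRl]),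
          List.take_append_of_le_length (by simp [hRl])])
      (by simp only [FreeSemigroup.suffixOf, hu, hv, Nat.add_sub_cancel, hsuf])
      (by
        ext f
        simp only [FreeSemigroup.factorsOf, hu, hv, Set.mem_ofPred_eq]
        exact and_congr_right (hf f))
    have := congrArg (fun a : T => (a : WithOne T)) this
    simp only [hval, hu, hv, List.map_append, List.prod_append, hRp] at this
    exact this
  -- The middle `R` is long enough to separate `x` from `y`, so the factors depend neither on the
  -- order of `x` and `y` nor on repetition.
  have split : ∀ (x y : T) (f : List T), f.length = j + 1 →
      (f <:+: R ++ (x :: (R ++ [y])) ++ R ↔ f <:+: R ++ [x] ++ R ∨ f <:+: R ++ [y] ++ R) := by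
    intro x y f hf
    have := List.infix_append_append_iff (f := f) (X := R ++ [x]) (Y := R) (Z := [y] ++ R)
      (by omega)
    simpa using this
  have hxe : e * x = x := by rw [← hx, ← mul_assoc, ← mul_assoc, he.eq]
  have hxe' : x * e = x := by rw [← hx, mul_assoc, he.eq]
  have hye : e * y = y := by rw [← hy, ← mul_assoc, ← mul_assoc, he.eq]
  have hye' : y * e = y := by rw [← hy, mul_assoc, he.eq]
  constructor
  · have := key (x :: (R ++ [y])) (y :: (R ++ [x])) fun f hf => by
      rw [split x y f hf, split y x f hf, or_comm]
    simp only [List.map_cons, List.map_append, List.prod_cons, List.prod_append, hRp,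
      List.map_nil, List.prod_nil, mul_one, ← WithOne.coe_mul, WithOne.coe_inj] at this
    simpa only [hye, hye', hxe, hxe', ← mul_assoc, mul_assoc x y e, mul_assoc y x e] using this
  · have := key (x :: (R ++ [x])) [x] fun f hf => by
      rw [split x x f hf, or_self]
    simp only [List.map_cons, List.map_append, List.prod_cons, List.prod_append, hRp,
      List.map_nil, List.prod_nil, mul_one, ← WithOne.coe_mul, WithOne.coe_inj] at this
    simpa only [hxe, hxe', ← mul_assoc, mul_assoc x x e] using this

theorem IsKTestableSemigroup.comm_and_idem_of_subsemigroup {k : ℕ} (hk : 0 < k)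
    {T : Subsemigroup S} (h : IsKTestableSemigroup k T) {e : S} (he : IsIdempotentElem e)
    (hT : Subsemigroup.eSe e ≤ T) (s t : S) :
    (e * s * e) * (e * t * e) = (e * t * e) * (e * s * e) ∧
      (e * s * e) * (e * s * e) = e * s * e := by
  have mem : ∀ s, e * s * e ∈ T := fun s => hT ⟨s, rfl⟩
  have heT : e ∈ T := by simpa [he.eq] using mem e
  have stab : ∀ s, e * (e * s * e) * e = e * s * e := fun s => by
    rw [← mul_assoc, ← mul_assoc, he.eq, mul_assoc _ e e, he.eq]
  have := h.comm_and_idem hk (e := ⟨e, heT⟩) (x := ⟨_, mem s⟩) (y := ⟨_, mem t⟩)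
    (Subtype.ext he) (Subtype.ext (stab s)) (Subtype.ext (stab t))
  exact ⟨congrArg Subtype.val this.1, congrArg Subtype.val this.2⟩

theorem Subsemigroup.isKTestableSemigroup_eSe_iff {e : S} (he : IsIdempotentElem e) :
    IsKTestableSemigroup 1 (Subsemigroup.eSe e) ↔
      (∀ x y : Subsemigroup.eSe e, x * y = y * x) ∧ (∀ x : Subsemigroup.eSe e, x * x = x) := by
  constructor
  · intro h
    have := h.comm_and_idem_of_subsemigroup one_pos he le_rfl
    constructor
    · rintro ⟨_, s, rfl⟩ ⟨_, t, rfl⟩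
      exact Subtype.ext (this s t).1
    · rintro ⟨_, s, rfl⟩
      exact Subtype.ext (this s s).2
  · rintro ⟨hc, hi⟩
    exact isKTestableSemigroup_one_of_comm_idem hc hi

theorem Subsemigroup.eSe_le_Se (e : S) : Subsemigroup.eSe e ≤ Subsemigroup.Se e := by
  rintro _ ⟨s, rfl⟩
  exact ⟨e * s, rfl⟩

theorem Subsemigroup.eSe_le_eS (e : S) : Subsemigroup.eSe e ≤ Subsemigroup.eS e := by
  rintro _ ⟨s, rfl⟩
  exact ⟨s * e, mul_assoc _ _ _⟩

theorem Subsemigroup.Se_le_SeS {e : S} (he : IsIdempotentElem e) :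
    Subsemigroup.Se e ≤ Subsemigroup.SeS e := by
  rintro _ ⟨s, rfl⟩
  exact ⟨s, e, by rw [mul_assoc, he.eq]⟩

theorem Subsemigroup.eS_le_SeS {e : S} (he : IsIdempotentElem e) :
    Subsemigroup.eS e ≤ Subsemigroup.SeS e := by
  rintro _ ⟨s, rfl⟩
  exact ⟨e, s, by rw [he.eq]⟩

end Testable

theorem theoreml1 (S : Type u) [Semigroup S] [Finite S] :
    List.TFAE
      [ IsLocallyTestableSemigroup S,
        ∀ e : S, IsIdempotentElem e → IsKTestableSemigroup 1 (Subsemigroup.eSe e),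
        ∀ e : S, IsIdempotentElem e → IsKTestableSemigroup 2 (Subsemigroup.Se e),
        ∀ e : S, IsIdempotentElem e → IsKTestableSemigroup 2 (Subsemigroup.eS e),
        ∀ e : S, IsIdempotentElem e → IsKTestableSemigroup 2 (Subsemigroup.SeS e) ] ∧
    ∀ e : S, IsIdempotentElem e →
      (IsKTestableSemigroup 1 (Subsemigroup.eSe e) ↔
        (∀ x y : Subsemigroup.eSe e, x * y = y * x) ∧
        (∀ x : Subsemigroup.eSe e, x * x = x)) := by
  refine ⟨?_, fun e he => Subsemigroup.isKTestableSemigroup_eSe_iff he⟩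
  have hloc : IsLocalSemilattice S →
      ∀ e : S, IsIdempotentElem e → IsKTestableSemigroup 1 (Subsemigroup.eSe e) := by
    refine fun hS e he => (Subsemigroup.isKTestableSemigroup_eSe_iff he).2 ⟨?_, ?_⟩
    · rintro ⟨_, s, rfl⟩ ⟨_, t, rfl⟩
      exact Subtype.ext (hS e he s t).1
    · rintro ⟨_, s, rfl⟩
      exact Subtype.ext (hS e he s s).2
  have hloc' : (∀ e : S, IsIdempotentElem e → IsKTestableSemigroup 1 (Subsemigroup.eSe e)) →
      IsLocalSemilattice S := fun h e he =>
    (h e he).comm_and_idem_of_subsemigroup one_pos he le_rfl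
  tfae_have 1 → 2 := by
    rintro ⟨k, hk, h⟩
    refine hloc fun e he s t => ?_
    have stab : ∀ s, e * (e * s * e) * e = e * s * e := fun s => by
      rw [← mul_assoc, ← mul_assoc, he.eq, mul_assoc _ e e, he.eq]
    exact h.comm_and_idem hk he (stab s) (stab t)
  tfae_have 2 → 1 := fun h => (hloc' h).isLocallyTestable
  tfae_have 2 → 5 := fun h e he => (hloc' h).isKTestableSemigroup_SeS he
  tfae_have 5 → 3 := fun h e he => (h e he).of_le (Subsemigroup.Se_le_SeS he)
  tfae_have 5 → 4 := fun h e he => (h e he).of_le (Subsemigroup.eS_le_SeS he)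
  tfae_have 3 → 2 := fun h => hloc fun e he =>
    (h e he).comm_and_idem_of_subsemigroup two_pos he (Subsemigroup.eSe_le_Se e)
  tfae_have 4 → 2 := fun h => hloc fun e he =>
    (h e he).comm_and_idem_of_subsemigroup two_pos he (Subsemigroup.eSe_le_eS e)
  tfae_finish
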